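/- Let $n\ge 0$ and let $S_n$ act on $C_2^n=\{0,1\}^n$ by permuting coordinates. The Burnside process on $C_2^n$ is the Markov chain that from $x$ chooses $\sigma$ uniformly in the stabilizer $G_x=\{\sigma\in S_n:\sigma x=x\}$ and then moves to a point $y$ chosen uniformly in $X_\sigma=\{y\in C_2^n:\sigma y=y\}$; its transition matrix is $K(x,y)=\sum_{\sigma\in G_x\cap G_y}\frac{1}{|G_x|}\frac{1}{|X_\sigma|}$. Let $Q$ be the transition matrix on $\{0,1,\dots,n\}$ of this chain lumped to the number $|x|$ of ones, i.e. $Q(i,j)=\sum_{y:|y|=j}K(x,y)$ for any $x$ with $|x|=i$ (this does not depend on $x$), acting on functions by $Qf(i)=\sum_j Q(i,j)f(j)$. For $0\le j\le n$ let $T_j^n$ be the discrete Chebyshev polynomial of degree $j$ on $\{0,\dots,n\}$ (the orthogonal polynomial of degree $j$ for the uniform distribution on $\{0,\dots,n\}$, normalized by $T^n_j(0)=1$), $$T_j^n(x)=\sum_{l=0}^{j}\frac{(-j)_l\,(j+1)_l\,(-x)_l}{(1)_l\,(-n)_l\,l!},\qquad (a)_l=a(a+1)\cdots(a+l-1).$$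 **Theorem.** The nonzero eigenvalues of $Q$ are exactly $1$ and $\binom{2k}{k}^2/2^{4k}$ for $1\le k\le\lfloor n/2\rfloor$, and each of them is simple. The eigenspace for the eigenvalue $1$ consists of the constant functions (multiples of $T_0^n=1$). For each integer $k$ with $1\le k\le n/2$, $T_{2k}^n$ is an eigenfunction of $Q$ with eigenvalue $\binom{2k}{k}^2/2^{4k}$, and it spans the eigenspace. Each $T_j^n$ with $j$ odd, $j\le n$, is an eigenfunction of $Q$ with eigenvalue $0$, and these $T_j^n$ span the kernel of $Q$. -/

import Mathlib

open Polynomial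

open scoped Classical in
/-- The transition matrix of the Burnside process of a finite group `G` acting on a set `X`:
from `x` choose `g` uniformly in the stabilizer of `x`, then choose `y` uniformly among the
points fixed by `g`; that is
`K(x, y) = ∑_{g ∈ G_x ∩ G_y} (1 / |G_x|) * (1 / |X_g|)`. -/
noncomputable def burnsideKernel (G X : Type*) [Group G] [Fintype G] [MulAction G X] :
    Matrix X X ℝ := fun x y =>
  ∑ g : G with g ∈ MulAction.stabilizer G x ∧ g ∈ MulAction.stabilizer G y,
    (1 / (Nat.card (MulAction.stabilizer G x) : ℝ)) *
      (1 / (Nat.card (MulAction.fixedBy X g) : ℝ))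

/-- The action of `S_n` on `C_2^n` by permuting coordinates: `(σ • x) i = x (σ⁻¹ i)`. -/
@[reducible] def coordAction (n : ℕ) :
    MulAction (Equiv.Perm (Fin n)) (Fin n → ZMod 2) := arrowAction

/-- The Burnside process on `C_2^n` under `S_n`. -/
noncomputable def binaryBurnside (n : ℕ) : Matrix (Fin n → ZMod 2) (Fin n → ZMod 2) ℝ :=
  letI := coordAction n
  burnsideKernel (Equiv.Perm (Fin n)) (Fin n → ZMod 2)

/-- The number of ones of a binary `n`-tuple, as an element of `{0, …, n}`. -/
def numOnes {n : ℕ} (x : Fin n → ZMod 2) : Fin (n + 1) :=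
  ⟨(Finset.univ.filter fun i => x i = 1).card,
    Nat.lt_succ_of_le (by simpa using Finset.card_filter_le (Finset.univ : Finset (Fin n)) _)⟩

/-- The binary `n`-tuple `(1, …, 1, 0, …, 0)` with exactly `i` ones. -/
def onesFirst {n : ℕ} (i : Fin (n + 1)) : Fin n → ZMod 2 :=
  fun k => if (k : ℕ) < (i : ℕ) then 1 else 0

/-- The transition matrix of the Burnside process on `C_2^n` under `S_n` lumped to the number of
ones: `Q(i, j)` is the probability that one step from a tuple with `i` ones leads to a tuple with
`j` ones. By `lumpedKernel_numOnes` below, the choice of the starting tuple is irrelevant. -/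
noncomputable def lumpedKernel (n : ℕ) : Matrix (Fin (n + 1)) (Fin (n + 1)) ℝ := fun i j =>
  ∑ y : Fin n → ZMod 2 with numOnes y = j, binaryBurnside n (onesFirst i) y

theorem numOnes_onesFirst {n : ℕ} (i : Fin (n + 1)) :
    numOnes (onesFirst i : Fin n → ZMod 2) = i := by
  apply Fin.ext
  have h : (Finset.univ.filter fun k : Fin n => (onesFirst i : Fin n → ZMod 2) k = 1)
      = Finset.univ.filter fun k : Fin n => (k : ℕ) < i := by
    ext k
    by_cases hk : (k : ℕ) < i <;> simp [onesFirst, hk]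
  simp only [numOnes, h, Fin.card_filter_val_lt]
  omega

theorem burnsideKernel_smul (G X : Type*) [Group G] [Fintype G] [MulAction G X]
    (s : G) (x y : X) : burnsideKernel G X (s • x) (s • y) = burnsideKernel G X x y := by
  classical
  have hst : ∀ (g : G) (z : X), s * g * s⁻¹ ∈ MulAction.stabilizer G (s • z) ↔
      g ∈ MulAction.stabilizer G z := by
    intro g z
    simp [MulAction.mem_stabilizer_iff, mul_smul]
  symm
  unfold burnsideKernel
  refine Finset.sum_bij' (fun g _ => s * g * s⁻¹) (fun g _ => s⁻¹ * g * s) ?_ ?_ ?_ ?_ ?_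
  · intro g hg
    simpa [hst, -MulAction.mem_stabilizer_iff] using hg
  · intro g hg
    have h1 := hst (s⁻¹ * g * s)
    simp only [← mul_assoc, mul_inv_cancel, one_mul, mul_inv_cancel_right] at h1
    simpa only [Finset.mem_filter, Finset.mem_univ, true_and, h1] using hg
  · intro g _
    group
  · intro g _
    group
  · intro g _
    have e1 : Nat.card (MulAction.stabilizer G x) = Nat.card (MulAction.stabilizer G (s • x)) :=
      Nat.card_congr ((MulAut.conj s).toEquiv.subtypeEquiv fun g => by
        simpa using (hst g x).symm)
    have e2 : Nat.card (MulAction.fixedBy X g) = Nat.card (MulAction.fixedBy X (s * g * s⁻¹)) :=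
      Nat.card_congr ((MulAction.toPerm s).subtypeEquiv fun z => by
        simp [MulAction.mem_fixedBy, mul_smul])
    rw [e1, e2]

/-- Lumpability: from every tuple `x`, the probability of moving to a tuple with `j` ones is
`Q(|x|, j)`. -/
theorem lumpedKernel_numOnes (n : ℕ) (x : Fin n → ZMod 2) (j : Fin (n + 1)) :
    ∑ y : Fin n → ZMod 2 with numOnes y = j, binaryBurnside n x y =
      lumpedKernel n (numOnes x) j := by
  classical
  let _ := coordAction n
  have hsm : ∀ (s : Equiv.Perm (Fin n)) (y : Fin n → ZMod 2) (i : Fin n),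
      (s • y) i = y (s⁻¹ i) := fun _ _ _ => rfl
  have hcard : ∀ (s : Equiv.Perm (Fin n)) (y : Fin n → ZMod 2), numOnes (s • y) = numOnes y := by
    intro s y
    apply Fin.ext
    simp only [numOnes]
    refine Finset.card_bij' (fun i _ => s⁻¹ i) (fun i _ => s i) ?_ ?_ ?_ ?_ <;> simp [hsm]
  have hex : ∃ s : Equiv.Perm (Fin n), s • x = onesFirst (numOnes x) := by
    have hc : Fintype.card {i // x i = 1} =
        Fintype.card {i // (onesFirst (numOnes x) : Fin n → ZMod 2) i = 1} := by
      have h := congrArg Fin.val (numOnes_onesFirst (numOnes x))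
      simp only [numOnes] at h
      rw [Fintype.card_subtype, Fintype.card_subtype]
      exact h.symm
    let e := Fintype.equivOfCardEq hc
    refine ⟨e.extendSubtype, ?_⟩
    funext i
    rw [hsm]
    have h01 : ∀ a b : ZMod 2, (a = 1 ↔ b = 1) → a = b := by decide
    apply h01
    obtain ⟨k, rfl⟩ := e.extendSubtype.surjective i
    rw [show e.extendSubtype⁻¹ (e.extendSubtype k) = k from e.extendSubtype.symm_apply_apply k]
    constructor
    · intro hk
      exact e.extendSubtype_mem k hk
    · intro hk
      by_contra hk'
      exact e.extendSubtype_not_mem k hk' hk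
  obtain ⟨s, hs⟩ := hex
  unfold lumpedKernel
  rw [← hs]
  refine Finset.sum_bij' (fun y _ => s • y) (fun y _ => s⁻¹ • y) ?_ ?_ ?_ ?_ ?_
  · intro y hy
    simpa [hcard] using hy
  · intro y hy
    simpa [hcard] using hy
  · intro y _
    simp
  · intro y _
    simp
  · intro y _
    exact (burnsideKernel_smul (Equiv.Perm (Fin n)) (Fin n → ZMod 2) s x y).symm

/-- The discrete Chebyshev polynomial of degree `j` on `{0, …, n}` (for `j ≤ n`), normalized to be
`1` at `0`: the terminating hypergeometric series
`₃F₂(-j, j + 1, -x; 1, -n | 1) = ∑_{l ≤ j} (-j)_l (j+1)_l (-x)_l / ((1)_l (-n)_l l!)`,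
where `(a)_l = a (a + 1) ⋯ (a + l - 1)`. -/
noncomputable def discreteChebyshev (n j : ℕ) : ℝ[X] :=
  ∑ l ∈ Finset.range (j + 1),
    C ((ascPochhammer ℝ l).eval (-(j : ℝ)) * (ascPochhammer ℝ l).eval ((j : ℝ) + 1) /
        ((ascPochhammer ℝ l).eval 1 * (ascPochhammer ℝ l).eval (-(n : ℝ)) *
          (Nat.factorial l : ℝ))) *
      (ascPochhammer ℝ l).comp (-X)

/-- The discrete Chebyshev polynomial of degree `j` as a function on `{0, …, n}`. -/
noncomputable def chebyshevFun (n j : ℕ) : Fin (n + 1) → ℝ :=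
  fun x => (discreteChebyshev n j).eval (x : ℝ)

/-- The number `binom(2k, k)^2 / 2^(4k)`. -/
noncomputable def burnsideEigenvalue (k : ℕ) : ℝ :=
  (Nat.choose (2 * k) k : ℝ) ^ 2 / 2 ^ (4 * k)

/-! Write a_m = binom(2m, m) / 4^m, so that m! a_m is the rising factorial (1/2)_m. Building a
permutation by inserting one point at a time, a new cycle contributes 1/2 and an insertion into an
existing cycle contributes 1. Hence the sum of 1/|X_σ| over the σ preserving a colouring is the
product of m! a_m over its colour classes. Colouring i by (x i, y i) makes K explicit: from a state
with i ones, the numbers of ones and of zeros that become ones are independent, with weights a_p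
a_{i-p} and a_q a_{n-i-q}.

These weights are symmetric under transposing the 2×2 table of overlaps, so Q is a symmetric matrix
(`lumpedKernel_isSymm`). Their factorial moments are a_s binom(i, s), so Q sends binom(·, r) to ∑
a_s a_t binom(i, s) binom(n-i, t) over s + t = r. This has degree at most r in i, so Q preserves the
filtration by degree. On its r-th quotient Q acts by the scalar r! ∑ (-1)^t a_s a_t / (s! t!), which
is r! times a coefficient of A(X) A(-X), where A = ∑ a_s X^s / s! = exp(X/2) I_0(X/2). The
exponentials cancel and I_0(X/2)² remains: odd coefficients vanish, even ones give a_k².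

A symmetric operator preserving the filtration has the orthogonal polynomials as eigenvectors
(`toLin'_chebyshevFun`). They form a basis, and a_k² is positive and strictly decreasing, so
distinct even degrees have distinct eigenvalues. -/

/-! ### Arcsine weights -/

/-- The weight `binom(2m, m) / 4^m` of the discrete arcsine distribution. -/
noncomputable def arcsineWeight (m : ℕ) : ℝ := (Nat.centralBinom m : ℝ) / 4 ^ m

theorem arcsineWeight_zero : arcsineWeight 0 = 1 := by simp [arcsineWeight]

theorem arcsineWeight_pos (m : ℕ) : 0 < arcsineWeight m := by
  have := Nat.centralBinom_pos m
  unfold arcsineWeight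
  positivity

theorem succ_mul_arcsineWeight_succ (m : ℕ) :
    ((m : ℝ) + 1) * arcsineWeight (m + 1) = (m + 1 / 2) * arcsineWeight m := by
  have h : ((m : ℝ) + 1) * Nat.centralBinom (m + 1) = 2 * (2 * m + 1) * Nat.centralBinom m := by
    exact_mod_cast Nat.succ_mul_centralBinom_succ m
  simp only [arcsineWeight, pow_succ]
  field_simp
  linear_combination 2 * h

theorem factorial_succ_mul_arcsineWeight_succ (m : ℕ) :
    ((m + 1).factorial : ℝ) * arcsineWeight (m + 1) =
      (1 / 2 + m) * ((m.factorial : ℝ) * arcsineWeight m) := by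
  rw [Nat.factorial_succ]
  push_cast
  linear_combination (m.factorial : ℝ) * succ_mul_arcsineWeight_succ m

/-! ### Summing over the permutations that preserve a colouring -/

/-- The permutation is `e`, extended to fix 0, followed by the swap of 0 and `p`. The swap is
invisible to `z` once 0 and `p` have the same colour. -/
theorem comp_decomposeFin_symm_eq_iff {n : ℕ} {C : Type*} (z : Fin (n + 1) → C) (p : Fin (n + 1))
    (e : Equiv.Perm (Fin n)) :
    z ∘ Equiv.Perm.decomposeFin.symm (p, e) = z ↔
      z p = z 0 ∧ (fun i => z (Fin.succ i)) ∘ e = fun i => z (Fin.succ i) := by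
  have hswap : z p = z 0 → ∀ q, z (Equiv.swap 0 p q) = z q := by
    intro h q
    rw [Equiv.swap_apply_def]
    split_ifs with h1 h2
    · rw [h, h1]
    · rw [h2, h]
    · rfl
  constructor
  · intro h
    have h0 : z p = z 0 := by simpa using congrFun h 0
    refine ⟨h0, funext fun i => ?_⟩
    have := congrFun h i.succ
    simpa [hswap h0] using this
  · rintro ⟨h0, h⟩
    funext i
    refine Fin.cases ?_ (fun k => ?_) i
    · simpa using h0
    · simpa [hswap h0] using congrFun h k

/-- For `p = 0` the point 0 is a cycle of its own, and its colour is free. -/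
theorem card_invariant_decomposeFin_zero {n : ℕ} (e : Equiv.Perm (Fin n)) :
    Nat.card {y : Fin (n + 1) → ZMod 2 // y ∘ Equiv.Perm.decomposeFin.symm (0, e) = y} =
      2 * Nat.card {y : Fin n → ZMod 2 // y ∘ e = y} := by
  have h2 : 2 * Nat.card {y : Fin n → ZMod 2 // y ∘ e = y} =
      Nat.card (ZMod 2 × {y : Fin n → ZMod 2 // y ∘ e = y}) := by simp
  rw [h2]
  refine Nat.card_congr
    { toFun := fun y => (y.1 0, ⟨fun i => y.1 i.succ,
        ((comp_decomposeFin_symm_eq_iff _ _ _).1 y.2).2⟩)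
      invFun := fun y => ⟨Fin.cons y.1 y.2.1, (comp_decomposeFin_symm_eq_iff _ _ _).2
        ⟨rfl, by simpa using y.2.2⟩⟩
      left_inv := ?_
      right_inv := ?_ }
  · rintro ⟨y, hy⟩
    apply Subtype.ext
    funext i
    refine Fin.cases ?_ (fun k => ?_) i <;> simp
  · rintro ⟨a, y, hy⟩
    simp

/-- For `p ≠ 0` the point 0 joins the cycle of `k`, which dictates its colour. -/
theorem card_invariant_decomposeFin_succ {n : ℕ} (k : Fin n) (e : Equiv.Perm (Fin n)) :
    Nat.card {y : Fin (n + 1) → ZMod 2 // y ∘ Equiv.Perm.decomposeFin.symm (k.succ, e) = y} =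
      Nat.card {y : Fin n → ZMod 2 // y ∘ e = y} := by
  refine Nat.card_congr
    { toFun := fun y => ⟨fun i => y.1 i.succ,
        ((comp_decomposeFin_symm_eq_iff _ _ _).1 y.2).2⟩
      invFun := fun y => ⟨Fin.cons (y.1 k) y.1, (comp_decomposeFin_symm_eq_iff _ _ _).2
        ⟨by simp, by simpa using y.2⟩⟩
      left_inv := ?_
      right_inv := ?_ }
  · rintro ⟨y, hy⟩
    apply Subtype.ext
    funext i
    have h0 := ((comp_decomposeFin_symm_eq_iff _ _ _).1 hy).1
    refine Fin.cases ?_ (fun j => ?_) i <;> simp [h0]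
  · rintro ⟨y, hy⟩
    simp

/-- Summing `1 / #{binary colourings fixed by σ}` over the permutations `σ` preserving a given
colouring `z` gives a product over the colour classes. -/
theorem sum_one_div_card_invariant {C : Type*} [Fintype C] [DecidableEq C] {n : ℕ}
    (z : Fin n → C) :
    ∑ σ : Equiv.Perm (Fin n), (if z ∘ σ = z then
        1 / (Nat.card {y : Fin n → ZMod 2 // y ∘ σ = y} : ℝ) else 0) =
      ∏ c, (((Finset.univ.filter fun i => z i = c).card.factorial : ℝ) *
        arcsineWeight (Finset.univ.filter fun i => z i = c).card) := by
  induction n with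
  | zero =>
    simp [arcsineWeight_zero, Subsingleton.elim _ z]
  | succ n ih =>
    have ih' := ih fun i => z i.succ
    rw [← Equiv.Perm.decomposeFin.symm.sum_comp, Fintype.sum_prod_type, Fin.sum_univ_succ]
    simp only [card_invariant_decomposeFin_zero, card_invariant_decomposeFin_succ]
    simp only [comp_decomposeFin_symm_eq_iff, true_and]
    have h1 : ∀ k : Fin n, (∑ e : Equiv.Perm (Fin n),
        if z k.succ = z 0 ∧ ((fun i => z (Fin.succ i)) ∘ e = fun i => z (Fin.succ i)) then
          1 / (Nat.card {y : Fin n → ZMod 2 // y ∘ e = y} : ℝ) else 0) =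
        if z k.succ = z 0 then ∏ c,
          (((Finset.univ.filter fun i : Fin n => z i.succ = c).card.factorial : ℝ) *
          arcsineWeight (Finset.univ.filter fun i : Fin n => z i.succ = c).card) else 0 := by
      intro k
      by_cases hk : z k.succ = z 0
      · simp only [hk, true_and, if_true]
        exact ih'
      · simp [hk]
    have h2 : (∑ e : Equiv.Perm (Fin n),
        if ((fun i => z (Fin.succ i)) ∘ e = fun i => z (Fin.succ i)) then
          1 / ((2 * Nat.card {y : Fin n → ZMod 2 // y ∘ e = y} : ℕ) : ℝ) else 0) =
        1 / 2 * ∏ c,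
          (((Finset.univ.filter fun i : Fin n => z i.succ = c).card.factorial : ℝ) *
          arcsineWeight (Finset.univ.filter fun i : Fin n => z i.succ = c).card) := by
      rw [← ih', Finset.mul_sum]
      refine Finset.sum_congr rfl fun e _ => ?_
      split_ifs
      · push_cast
        rw [one_div_mul_one_div]
      · simp
    rw [h2, Finset.sum_congr rfl fun k _ => h1 k, Finset.sum_ite, Finset.sum_const_zero, add_zero,
      Finset.sum_const, nsmul_eq_mul, ← add_mul]
    -- Only the class of the colour of 0 grows, by the factor 1/2 + m of the rising factorial: 1/2
    -- from the new cycle, m from the points of that colour beside which 0 can be inserted.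
    have h3 : ∀ c, (((Finset.univ.filter fun i => z i = c).card.factorial : ℝ) *
        arcsineWeight (Finset.univ.filter fun i => z i = c).card) =
        (if z 0 = c then (1 / 2 + ((Finset.univ.filter fun i : Fin n => z i.succ = c).card : ℝ))
          else 1) *
        (((Finset.univ.filter fun i : Fin n => z i.succ = c).card.factorial : ℝ) *
          arcsineWeight (Finset.univ.filter fun i : Fin n => z i.succ = c).card) := by
      intro c
      rw [Fin.card_filter_univ_succ]
      split_ifs with hc
      · exact factorial_succ_mul_arcsineWeight_succ _
      · rw [one_mul]
    rw [Finset.prod_congr rfl fun c _ => h3 c]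
    conv_rhs => rw [Finset.prod_mul_distrib, Finset.prod_ite_eq]
    simp

/-! ### Closed form of the Burnside kernel -/

theorem card_stabilizer_coordAction {n : ℕ} (x : Fin n → ZMod 2) :
    letI := coordAction n
    Nat.card (MulAction.stabilizer (Equiv.Perm (Fin n)) x) =
      ∏ c, (Finset.univ.filter fun i => x i = c).card.factorial := by
  let _ := coordAction n
  have h := DomMulAct.stabilizer_card x
  simp only [Fintype.card_subtype] at h
  rw [← h, ← Fintype.card_subtype, ← Nat.card_eq_fintype_card]
  refine Nat.card_congr ((Equiv.inv _).subtypeEquiv fun g => ?_)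
  rfl

theorem binaryBurnside_eq {n : ℕ} (x y : Fin n → ZMod 2) :
    binaryBurnside n x y =
      (∏ c, ((Finset.univ.filter fun i => x i = c).card.factorial : ℝ))⁻¹ *
      ∏ c : ZMod 2 × ZMod 2,
        (((Finset.univ.filter fun i => (x i, y i) = c).card.factorial : ℝ) *
          arcsineWeight (Finset.univ.filter fun i => (x i, y i) = c).card) := by
  classical
  rw [← sum_one_div_card_invariant fun i => (x i, y i)]
  unfold binaryBurnside burnsideKernel
  rw [← Finset.mul_sum, card_stabilizer_coordAction]
  push_cast
  rw [one_div]
  congr 1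
  rw [Finset.sum_filter]
  -- The action is composition with `g⁻¹`, whereas the colouring sum uses composition with the
  -- permutation itself.
  refine Fintype.sum_equiv (Equiv.inv _) _ _ fun g => ?_
  have h1 : (g ∈ @MulAction.stabilizer _ _ _ (coordAction n) x ∧
      g ∈ @MulAction.stabilizer _ _ _ (coordAction n) y) ↔
      ((fun i => (x i, y i)) ∘ ⇑(g⁻¹) = fun i => (x i, y i)) := by
    constructor
    · rintro ⟨hx, hy⟩
      funext i
      exact Prod.ext (congrFun hx i) (congrFun hy i)
    · intro h
      exact ⟨funext fun i => congrArg Prod.fst (congrFun h i),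
        funext fun i => congrArg Prod.snd (congrFun h i)⟩
  simp only [h1]
  rfl

theorem sum_finset_card_inter_card_sdiff {α : Type*} [Fintype α] [DecidableEq α] (A : Finset α)
    (F : ℕ → ℕ → ℝ) :
    ∑ Y : Finset α, F (Y ∩ A).card (Y \ A).card =
      ∑ a ∈ Finset.range (A.card + 1), ∑ b ∈ Finset.range (Aᶜ.card + 1),
        (A.card.choose a : ℝ) * (Aᶜ.card.choose b : ℝ) * F a b := by
  have h1 : ∑ Y : Finset α, F (Y ∩ A).card (Y \ A).card =
      ∑ P ∈ A.powerset ×ˢ Aᶜ.powerset, F P.1.card P.2.card := by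
    refine Finset.sum_bij' (fun Y _ => (Y ∩ A, Y \ A)) (fun P _ => P.1 ∪ P.2) ?_ ?_ ?_ ?_ ?_
    · intro Y _
      simp only [Finset.mem_product, Finset.mem_powerset]
      exact ⟨Finset.inter_subset_right, fun i hi => by simpa using (Finset.mem_sdiff.1 hi).2⟩
    · intro P _
      exact Finset.mem_univ _
    · intro Y _
      ext i
      simp only [Finset.mem_union, Finset.mem_inter, Finset.mem_sdiff]
      tauto
    · rintro ⟨P, R⟩ h
      simp only [Finset.mem_product, Finset.mem_powerset] at h
      have h1 : ∀ i, i ∈ P → i ∈ A := fun i hi => h.1 hi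
      have h2 : ∀ i, i ∈ R → i ∉ A := fun i hi => by simpa using h.2 hi
      refine Prod.ext ?_ ?_ <;> ext i <;> have := h1 i <;> have := h2 i <;>
        simp only [Finset.mem_union, Finset.mem_inter, Finset.mem_sdiff] <;> tauto
    · intro Y _
      rfl
  rw [h1, Finset.sum_product]
  have h2 : ∀ a, ∑ R ∈ Aᶜ.powerset, F a R.card =
      ∑ b ∈ Finset.range (Aᶜ.card + 1), (Aᶜ.card.choose b : ℝ) * F a b := by
    intro a
    rw [Finset.sum_powerset_apply_card fun b => F a b]
    simp
  simp only [h2]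
  rw [Finset.sum_powerset_apply_card fun a =>
    ∑ b ∈ Finset.range (Aᶜ.card + 1), (Aᶜ.card.choose b : ℝ) * F a b]
  simp only [nsmul_eq_mul, Finset.mul_sum, mul_assoc]

/-- Binary tuples and their supports. -/
def binaryEquivFinset (n : ℕ) : (Fin n → ZMod 2) ≃ Finset (Fin n) where
  toFun y := Finset.univ.filter fun i => y i = 1
  invFun Y := fun i => if i ∈ Y then 1 else 0
  left_inv y := by
    funext i
    have h : ∀ a : ZMod 2, (if a = 1 then 1 else 0) = a := by decide
    simpa using h (y i)
  right_inv Y := by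
    ext i
    by_cases h : i ∈ Y <;> simp [h]

theorem zmod_two_eq_zero_iff (a : ZMod 2) : a = 0 ↔ ¬ a = 1 := by
  revert a; decide

/-- The binomials count the `y` with the same overlaps with `A` and `Aᶜ`. They absorb the factorials
of the four classes against those of the stabilizer, so a whole overlap pattern has a product of
arcsine weights as its probability. -/
theorem binaryBurnside_eq_of_support {n : ℕ} (x y : Fin n → ZMod 2) (A Y : Finset (Fin n))
    (hA : A = Finset.univ.filter fun i => x i = 1)
    (hY : Y = Finset.univ.filter fun i => y i = 1) :
    (A.card.choose (Y ∩ A).card : ℝ) * (Aᶜ.card.choose (Y \ A).card : ℝ) * binaryBurnside n x y =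
      arcsineWeight (Y ∩ A).card * arcsineWeight (A.card - (Y ∩ A).card) *
        (arcsineWeight (Y \ A).card * arcsineWeight (Aᶜ.card - (Y \ A).card)) := by
  have e1 : (Finset.univ.filter fun i => x i = 0) = Aᶜ := by
    ext i; simp [hA, zmod_two_eq_zero_iff]
  have e11 : (Finset.univ.filter fun i => (x i, y i) = ((1, 1) : ZMod 2 × ZMod 2)) = Y ∩ A := by
    ext i; simp [hA, hY, and_comm]
  have e10 : (Finset.univ.filter fun i => (x i, y i) = ((1, 0) : ZMod 2 × ZMod 2)) = A \ Y := by
    ext i; simp [hA, hY, zmod_two_eq_zero_iff]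
  have e01 : (Finset.univ.filter fun i => (x i, y i) = ((0, 1) : ZMod 2 × ZMod 2)) = Y \ A := by
    ext i; simp [hA, hY, zmod_two_eq_zero_iff, and_comm]
  have e00 : (Finset.univ.filter fun i => (x i, y i) = ((0, 0) : ZMod 2 × ZMod 2)) = Aᶜ \ Y := by
    ext i; simp [hA, hY, zmod_two_eq_zero_iff]
  have c10 : (A \ Y).card = A.card - (Y ∩ A).card := by
    rw [Finset.card_sdiff]
  have c00 : (Aᶜ \ Y).card = Aᶜ.card - (Y \ A).card := by
    rw [Finset.card_sdiff]
    congr 2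
    ext i; simp
  have u2 : (Finset.univ : Finset (ZMod 2)) = {0, 1} := by decide
  have l1 : (Y ∩ A).card ≤ A.card := Finset.card_le_card Finset.inter_subset_right
  have l2 : (Y \ A).card ≤ Aᶜ.card := Finset.card_le_card fun i hi => by
    simpa using (Finset.mem_sdiff.1 hi).2
  rw [binaryBurnside_eq, Fintype.prod_prod_type]
  simp only [u2, Finset.prod_insert (show (0 : ZMod 2) ∉ ({1} : Finset (ZMod 2)) by decide),
    Finset.prod_singleton, e1, ← hA, e11, e10, e01, e00, c10, c00]
  have k1 := Nat.choose_mul_factorial_mul_factorial l1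
  have k2 := Nat.choose_mul_factorial_mul_factorial l2
  rw [← k1, ← k2]
  have p1 : (A.card.choose (Y ∩ A).card : ℝ) ≠ 0 := by
    exact_mod_cast (Nat.choose_pos l1).ne'
  have p2 : (Aᶜ.card.choose (Y \ A).card : ℝ) ≠ 0 := by
    exact_mod_cast (Nat.choose_pos l2).ne'
  have q : ∀ m : ℕ, (m.factorial : ℝ) ≠ 0 := fun m => by exact_mod_cast m.factorial_ne_zero
  have q1 := q (Y ∩ A).card
  have q2 := q (Y \ A).card
  have q3 := q (A.card - (Y ∩ A).card)
  have q4 := q (Aᶜ.card - (Y \ A).card)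
  push_cast
  field_simp

/-! ### The lumped kernel as a pair of independent arcsine laws -/

theorem lumpedKernel_mulVec (n : ℕ) (g : ℕ → ℝ) (i : Fin (n + 1)) :
    Matrix.mulVec (lumpedKernel n) (fun j => g j) i =
      ∑ p ∈ Finset.HasAntidiagonal.antidiagonal (i : ℕ),
      ∑ q ∈ Finset.HasAntidiagonal.antidiagonal (n - (i : ℕ)),
        arcsineWeight p.1 * arcsineWeight p.2 * (arcsineWeight q.1 * arcsineWeight q.2) *
          g (p.1 + q.1) := by
  classical
  set x : Fin n → ZMod 2 := onesFirst i with hx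
  set A : Finset (Fin n) := Finset.univ.filter fun k => x k = 1 with hA
  have hAc : A.card = i := congrArg Fin.val (numOnes_onesFirst i)
  have hAcc : Aᶜ.card = n - i := by rw [Finset.card_compl, hAc, Fintype.card_fin]
  have h1 : Matrix.mulVec (lumpedKernel n) (fun j => g j) i =
      ∑ y : Fin n → ZMod 2, binaryBurnside n x y * g (numOnes y) := by
    simp only [Matrix.mulVec, dotProduct, lumpedKernel]
    rw [← Finset.sum_fiberwise Finset.univ (numOnes : (Fin n → ZMod 2) → Fin (n + 1))
      fun y => binaryBurnside n x y * g (numOnes y)]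
    refine Finset.sum_congr rfl fun j _ => ?_
    rw [Finset.sum_mul]
    refine Finset.sum_congr rfl fun y hy => ?_
    rw [(Finset.mem_filter.1 hy).2]
  -- The contribution of a single `y`; the division is undone when the `y` with equal overlaps are
  -- grouped.
  let F : ℕ → ℕ → ℝ := fun a b => arcsineWeight a * arcsineWeight (i - a) *
    (arcsineWeight b * arcsineWeight (n - i - b)) * g (a + b) /
      (((i : ℕ).choose a : ℝ) * ((n - (i : ℕ)).choose b : ℝ))
  have h2 : ∀ y : Fin n → ZMod 2, binaryBurnside n x y * g (numOnes y) =
      F (binaryEquivFinset n y ∩ A).card (binaryEquivFinset n y \ A).card := by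
    intro y
    have h := binaryBurnside_eq_of_support x y A (binaryEquivFinset n y) hA rfl
    have hn : ((numOnes y : Fin (n + 1)) : ℕ) =
        (binaryEquivFinset n y ∩ A).card + (binaryEquivFinset n y \ A).card := by
      rw [Finset.card_inter_add_card_sdiff]; rfl
    have l1 : (binaryEquivFinset n y ∩ A).card ≤ A.card :=
      Finset.card_le_card Finset.inter_subset_right
    have l2 : (binaryEquivFinset n y \ A).card ≤ Aᶜ.card := Finset.card_le_card fun i hi => by
      simpa using (Finset.mem_sdiff.1 hi).2
    have p1 : (A.card.choose (binaryEquivFinset n y ∩ A).card : ℝ) ≠ 0 := by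
      exact_mod_cast (Nat.choose_pos l1).ne'
    have p2 : (Aᶜ.card.choose (binaryEquivFinset n y \ A).card : ℝ) ≠ 0 := by
      exact_mod_cast (Nat.choose_pos l2).ne'
    simp only [F]
    rw [hn, ← hAcc, ← hAc, eq_div_iff (mul_ne_zero p1 p2), ← h]
    ring
  rw [h1, Finset.sum_congr rfl fun y _ => h2 y,
    (binaryEquivFinset n).sum_comp fun Y => F (Y ∩ A).card (Y \ A).card,
    sum_finset_card_inter_card_sdiff, hAc, hAcc, Finset.Nat.sum_antidiagonal_eq_sum_range_succ_mk]
  refine Finset.sum_congr rfl fun a ha => ?_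
  rw [Finset.Nat.sum_antidiagonal_eq_sum_range_succ_mk]
  refine Finset.sum_congr rfl fun b hb => ?_
  have p1 : ((i : ℕ).choose a : ℝ) ≠ 0 := by
    exact_mod_cast (Nat.choose_pos (Nat.lt_succ_iff.1 (Finset.mem_range.1 ha))).ne'
  have p2 : ((n - (i : ℕ)).choose b : ℝ) ≠ 0 := by
    exact_mod_cast (Nat.choose_pos (Nat.lt_succ_iff.1 (Finset.mem_range.1 hb))).ne'
  simp only [F]
  rw [mul_div_cancel₀ _ (mul_ne_zero p1 p2)]

theorem lumpedKernel_apply (n : ℕ) (i j : Fin (n + 1)) :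
    lumpedKernel n i j =
      ∑ P ∈ Finset.HasAntidiagonal.antidiagonal (i : ℕ) ×ˢ
          Finset.HasAntidiagonal.antidiagonal (n - (i : ℕ)) with P.1.1 + P.2.1 = (j : ℕ),
        arcsineWeight P.1.1 * arcsineWeight P.1.2 *
          (arcsineWeight P.2.1 * arcsineWeight P.2.2) := by
  have h := lumpedKernel_mulVec n (fun k => if k = j then 1 else 0) i
  rw [Finset.sum_filter, Finset.sum_product]
  simp only [mul_ite, mul_one, mul_zero] at h
  rw [← h]
  simp [Matrix.mulVec, dotProduct, Fin.val_inj]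

/-- Each term belongs to a 2×2 table with row sums i, n - i and column sums j, n - j. Transposing
the table exchanges i and j and keeps the weight. -/
theorem lumpedKernel_isSymm (n : ℕ) : (lumpedKernel n).IsSymm := by
  apply Matrix.IsSymm.ext
  intro i j
  rw [lumpedKernel_apply, lumpedKernel_apply]
  have hi := i.is_lt
  have hj := j.is_lt
  refine Finset.sum_bij' (fun P _ => ((P.1.1, P.2.1), (P.1.2, P.2.2)))
    (fun P _ => ((P.1.1, P.2.1), (P.1.2, P.2.2))) ?_ ?_ ?_ ?_ ?_
  · rintro ⟨⟨a, b⟩, c, d⟩ h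
    simp only [Finset.mem_filter, Finset.mem_product, Finset.HasAntidiagonal.mem_antidiagonal] at h ⊢
    omega
  · rintro ⟨⟨a, b⟩, c, d⟩ h
    simp only [Finset.mem_filter, Finset.mem_product, Finset.HasAntidiagonal.mem_antidiagonal] at h ⊢
    omega
  · intro P _
    rfl
  · intro P _
    rfl
  · intro P _
    ring

/-! ### Factorial moments and the action on binomials -/

/-- Formally the generating functions are multiples of x^s (1-x)^(-s-p) and (1-x)^(-q), so their
product has the same shape with p + q in place of p. The proof splits i + 1 - s as (a - s) + b. -/
theorem sum_antidiagonal_mul_recurrence (u v : ℕ → ℝ) (s p q : ℝ) (h0 : s * u 0 = 0)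
    (hu : ∀ a : ℕ, ((a : ℝ) + 1 - s) * u (a + 1) = (a + p) * u a)
    (hv : ∀ b : ℕ, ((b : ℝ) + 1) * v (b + 1) = (b + q) * v b) (i : ℕ) :
    ((i : ℝ) + 1 - s) * ∑ P ∈ Finset.HasAntidiagonal.antidiagonal (i + 1), u P.1 * v P.2 =
      (i + p + q) * ∑ P ∈ Finset.HasAntidiagonal.antidiagonal i, u P.1 * v P.2 := by
  have h1 : ((i : ℝ) + 1 - s) * ∑ P ∈ Finset.HasAntidiagonal.antidiagonal (i + 1), u P.1 * v P.2 =
      ∑ P ∈ Finset.HasAntidiagonal.antidiagonal (i + 1), ((P.1 : ℝ) - s) * u P.1 * v P.2 +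
      ∑ P ∈ Finset.HasAntidiagonal.antidiagonal (i + 1), u P.1 * ((P.2 : ℝ) * v P.2) := by
    rw [Finset.mul_sum, ← Finset.sum_add_distrib]
    refine Finset.sum_congr rfl fun P hP => ?_
    have : (P.1 : ℝ) + P.2 = i + 1 := by
      exact_mod_cast Finset.HasAntidiagonal.mem_antidiagonal.1 hP
    rw [← this]
    ring
  rw [h1, Finset.Nat.sum_antidiagonal_succ, Finset.Nat.sum_antidiagonal_succ', Finset.mul_sum]
  have h2 : ((0 : ℕ) - s) * u 0 * v (i + 1) = 0 := by
    push_cast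
    linear_combination (-v (i + 1)) * h0
  rw [h2, Nat.cast_zero, zero_mul, mul_zero, zero_add, zero_add]
  rw [← Finset.sum_add_distrib]
  refine Finset.sum_congr rfl fun P hP => ?_
  have : (P.1 : ℝ) + P.2 = i := by
    exact_mod_cast Finset.HasAntidiagonal.mem_antidiagonal.1 hP
  push_cast
  rw [← this]
  linear_combination v P.2 * hu P.1 + u P.1 * hv P.2

/-- The factorial moments of the discrete arcsine distribution. -/
theorem sum_antidiagonal_arcsineWeight_mul_choose (i s : ℕ) :
    ∑ P ∈ Finset.HasAntidiagonal.antidiagonal i,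
        arcsineWeight P.1 * arcsineWeight P.2 * (P.1.choose s : ℝ) =
      arcsineWeight s * (i.choose s : ℝ) := by
  rcases lt_or_ge i s with h | h
  · rw [Nat.choose_eq_zero_of_lt h, Nat.cast_zero, mul_zero]
    refine Finset.sum_eq_zero fun P hP => ?_
    have := Finset.HasAntidiagonal.mem_antidiagonal.1 hP
    rw [Nat.choose_eq_zero_of_lt (by omega), Nat.cast_zero, mul_zero]
  induction i, h using Nat.le_induction with
  | base =>
    rw [Finset.sum_eq_single (s, 0)]
    · simp [arcsineWeight_zero]
    · rintro ⟨a, b⟩ hP hne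
      have h1 := Finset.HasAntidiagonal.mem_antidiagonal.1 hP
      have h2 : a < s := by
        by_contra h3
        exact hne (by ext <;> simp_all <;> omega)
      simp [Nat.choose_eq_zero_of_lt h2]
    · intro h
      exact absurd (Finset.HasAntidiagonal.mem_antidiagonal.2 (by simp)) h
  | succ i hi ih =>
    have hrec : ∀ a : ℕ, ((a : ℝ) + 1 - s) * ((a + 1).choose s : ℝ) = (a + 1) * (a.choose s : ℝ) := by
      intro a
      rcases lt_or_ge (a + 1) s with h | h
      · simp [Nat.choose_eq_zero_of_lt h, Nat.choose_eq_zero_of_lt (Nat.lt_of_succ_lt h)]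
      · have := Nat.choose_mul_succ_eq a s
        have h3 : (a.choose s : ℝ) * (a + 1) = (a + 1).choose s * ((a + 1 - s : ℕ) : ℝ) := by
          exact_mod_cast this
        rw [Nat.cast_sub h] at h3
        push_cast at h3
        linear_combination -h3
    -- With p = q = 1/2 the factor i + p + q is i + 1, which is the recurrence of `i.choose s`.
    have h := sum_antidiagonal_mul_recurrence (fun a => arcsineWeight a * (a.choose s : ℝ))
      arcsineWeight s (1 / 2) (1 / 2)
      (by cases s <;> simp)
      (fun a => by
        linear_combination arcsineWeight (a + 1) * hrec a +
          (a.choose s : ℝ) * succ_mul_arcsineWeight_succ a)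
      (fun b => succ_mul_arcsineWeight_succ b) i
    have hne : (i : ℝ) + 1 - s ≠ 0 := by
      have : (s : ℝ) ≤ i := by exact_mod_cast hi
      linarith
    apply mul_left_cancel₀ hne
    have e : ∀ m : ℕ, ∑ P ∈ Finset.HasAntidiagonal.antidiagonal m,
        arcsineWeight P.1 * arcsineWeight P.2 * (P.1.choose s : ℝ) =
        ∑ P ∈ Finset.HasAntidiagonal.antidiagonal m,
          arcsineWeight P.1 * (P.1.choose s : ℝ) * arcsineWeight P.2 := fun m =>
      Finset.sum_congr rfl fun P _ => by ring
    rw [e] at ih ⊢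
    rw [h, ih]
    linear_combination -(arcsineWeight s) * hrec i

/-- Vandermonde splits the binomial of a sum, and independence reduces each term to two factorial
moments. -/
theorem lumpedKernel_mulVec_choose (n r : ℕ) (i : Fin (n + 1)) :
    Matrix.mulVec (lumpedKernel n) (fun j => ((j : ℕ).choose r : ℝ)) i =
      ∑ P ∈ Finset.HasAntidiagonal.antidiagonal r, arcsineWeight P.1 * arcsineWeight P.2 *
        (((i : ℕ).choose P.1 : ℝ) * ((n - (i : ℕ)).choose P.2 : ℝ)) := by
  rw [lumpedKernel_mulVec n (fun j => (j.choose r : ℝ)) i]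
  have h : ∀ P : ℕ × ℕ, arcsineWeight P.1 * arcsineWeight P.2 *
        (((i : ℕ).choose P.1 : ℝ) * ((n - (i : ℕ)).choose P.2 : ℝ)) =
      (arcsineWeight P.1 * ((i : ℕ).choose P.1 : ℝ)) *
        (arcsineWeight P.2 * ((n - (i : ℕ)).choose P.2 : ℝ)) := fun P => by ring
  simp only [h, ← sum_antidiagonal_arcsineWeight_mul_choose, Finset.sum_mul_sum]
  conv_rhs => rw [Finset.sum_comm]
  refine Finset.sum_congr rfl fun p _ => ?_
  conv_rhs => rw [Finset.sum_comm]
  refine Finset.sum_congr rfl fun q _ => ?_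
  rw [Nat.add_choose_eq, Nat.cast_sum, Finset.mul_sum]
  refine Finset.sum_congr rfl fun P _ => ?_
  push_cast
  ring

/-! ### The eigenvalues from a Bessel generating function -/

/-- The exponential generating function of the arcsine weights. -/
noncomputable def arcsineEGF : PowerSeries ℝ :=
  PowerSeries.mk fun s => arcsineWeight s / (s.factorial : ℝ)

noncomputable def expSeries (c : ℝ) : PowerSeries ℝ :=
  PowerSeries.rescale c (PowerSeries.exp ℝ)

theorem expSeries_mul (a b : ℝ) : expSeries a * expSeries b = expSeries (a + b) :=
  PowerSeries.exp_mul_exp_eq_exp_add a b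

theorem derivative_expSeries (c : ℝ) :
    PowerSeries.derivative ℝ (expSeries c) = PowerSeries.C c * expSeries c := by
  ext m
  simp only [expSeries, PowerSeries.coeff_derivative, PowerSeries.coeff_rescale,
    PowerSeries.coeff_C_mul, PowerSeries.coeff_exp, Nat.factorial_succ, map_div₀, map_one,
    map_natCast]
  have : (m.factorial : ℝ) ≠ 0 := by exact_mod_cast m.factorial_ne_zero
  push_cast
  field_simp
  ring

/-- Kummer's equation for ₁F₁(1/2; 1; X), equivalent to the two-term recurrence of the weights. -/
theorem arcsineEGF_ode :
    PowerSeries.X * PowerSeries.derivative ℝ (PowerSeries.derivative ℝ arcsineEGF) +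
      (1 - PowerSeries.X) * PowerSeries.derivative ℝ arcsineEGF -
      PowerSeries.C (1 / 2) * arcsineEGF = 0 := by
  have hf : ∀ m : ℕ, (m.factorial : ℝ) ≠ 0 := fun m => by exact_mod_cast m.factorial_ne_zero
  have key : ∀ m : ℕ, ((m : ℝ) + 1) * (arcsineWeight (m + 1) / ((m + 1).factorial : ℝ) *
      ((m : ℝ) + 1)) = ((m : ℝ) + 1 / 2) * (arcsineWeight m / (m.factorial : ℝ)) := by
    intro m
    have := hf m
    rw [Nat.factorial_succ]
    push_cast
    field_simp
    linear_combination 2 * succ_mul_arcsineWeight_succ m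
  ext m
  rw [sub_mul, one_mul]
  cases m with
  | zero =>
    have := key 0
    simp only [map_add, map_sub, map_zero, PowerSeries.coeff_zero_X_mul,
      PowerSeries.coeff_derivative, PowerSeries.coeff_C_mul, arcsineEGF, PowerSeries.coeff_mk]
    push_cast at this ⊢
    linear_combination this
  | succ m =>
    have := key (m + 1)
    simp only [map_add, map_sub, map_zero, PowerSeries.coeff_succ_X_mul,
      PowerSeries.coeff_derivative, PowerSeries.coeff_C_mul, arcsineEGF, PowerSeries.coeff_mk]
    push_cast at this ⊢
    linear_combination this

/-- The exponential generating function divided by `exp (X / 2)`, a Bessel series. -/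
noncomputable def besselSeries : PowerSeries ℝ := arcsineEGF * expSeries (-1 / 2)

/-- The modified Bessel equation of I_0(X/2). Its recurrence advances by two indices, which forces
the series to be even. -/
theorem besselSeries_ode :
    PowerSeries.X * PowerSeries.derivative ℝ (PowerSeries.derivative ℝ besselSeries) +
      PowerSeries.derivative ℝ besselSeries =
      PowerSeries.C (1 / 4) * (PowerSeries.X * besselSeries) := by
  set c : PowerSeries ℝ := PowerSeries.C (1 / 2) with hc
  have hC2 : PowerSeries.C (1 / 4 : ℝ) = c * c := by
    rw [hc, ← map_mul]; norm_num
  have hC3 : c + c = 1 := by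
    rw [hc, ← map_add, ← map_one PowerSeries.C]; norm_num
  have hI : PowerSeries.derivative ℝ (expSeries (-1 / 2)) = -(c * expSeries (-1 / 2)) := by
    rw [derivative_expSeries, hc, ← neg_mul, ← map_neg, neg_div]
  have hdc : PowerSeries.derivative ℝ c = 0 := PowerSeries.derivative_C
  have h1 : PowerSeries.derivative ℝ besselSeries =
      (PowerSeries.derivative ℝ arcsineEGF - c * arcsineEGF) * expSeries (-1 / 2) := by
    rw [besselSeries, Derivation.leibniz, hI]
    simp only [smul_eq_mul]
    ring
  rw [h1, Derivation.leibniz, hI, map_sub, Derivation.leibniz, hdc, hC2, besselSeries]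
  simp only [smul_eq_mul]
  have ode := arcsineEGF_ode
  rw [← hc] at ode
  linear_combination expSeries (-1 / 2) * ode -
    PowerSeries.X * PowerSeries.derivative ℝ arcsineEGF * expSeries (-1 / 2) * hC3

theorem coeff_zero_besselSeries : PowerSeries.coeff 0 besselSeries = 1 := by
  rw [besselSeries, PowerSeries.coeff_mul, Finset.Nat.antidiagonal_zero, Finset.sum_singleton,
    arcsineEGF, expSeries, PowerSeries.coeff_mk, PowerSeries.coeff_rescale]
  simp [arcsineWeight_zero]

theorem coeff_one_besselSeries : PowerSeries.coeff 1 besselSeries = 0 := by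
  have h := congrArg (PowerSeries.coeff 0) besselSeries_ode
  simp only [map_add, PowerSeries.coeff_zero_X_mul, PowerSeries.coeff_derivative,
    PowerSeries.coeff_C_mul] at h
  simpa using h

theorem coeff_add_two_besselSeries (m : ℕ) :
    ((m : ℝ) + 2) ^ 2 * PowerSeries.coeff (m + 2) besselSeries =
      1 / 4 * PowerSeries.coeff m besselSeries := by
  have h := congrArg (PowerSeries.coeff (m + 1)) besselSeries_ode
  simp only [map_add, PowerSeries.coeff_succ_X_mul, PowerSeries.coeff_derivative,
    PowerSeries.coeff_C_mul] at h
  push_cast at h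
  rw [← h]
  ring

theorem coeff_besselSeries_of_odd (k : ℕ) :
    PowerSeries.coeff (2 * k + 1) besselSeries = 0 := by
  induction k with
  | zero => exact coeff_one_besselSeries
  | succ k ih =>
    have h := coeff_add_two_besselSeries (2 * k + 1)
    rw [ih, mul_zero] at h
    have hne : (((2 * k + 1 : ℕ) : ℝ) + 2) ^ 2 ≠ 0 := by positivity
    exact (mul_eq_zero.1 h).resolve_left hne

theorem coeff_besselSeries_two_mul (k : ℕ) :
    PowerSeries.coeff (2 * k) besselSeries = 1 / (16 ^ k * (k.factorial : ℝ) ^ 2) := by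
  induction k with
  | zero => simpa using coeff_zero_besselSeries
  | succ k ih =>
    have h := coeff_add_two_besselSeries (2 * k)
    rw [ih] at h
    have hne : (((2 * k : ℕ) : ℝ) + 2) ^ 2 ≠ 0 := by positivity
    apply mul_left_cancel₀ hne
    rw [show 2 * (k + 1) = 2 * k + 2 by ring, h, Nat.factorial_succ]
    push_cast
    have : (k.factorial : ℝ) ≠ 0 := by exact_mod_cast k.factorial_ne_zero
    field_simp
    ring

theorem rescale_neg_one_besselSeries : PowerSeries.rescale (-1 : ℝ) besselSeries = besselSeries := by
  ext m
  rw [PowerSeries.coeff_rescale]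
  rcases Nat.even_or_odd' m with ⟨k, rfl | rfl⟩
  · simp
  · simp [coeff_besselSeries_of_odd]

/-- A(X) = B(X) exp(X/2) with B even, so the exponentials cancel in A(X) A(-X). -/
theorem arcsineEGF_mul_rescale :
    arcsineEGF * PowerSeries.rescale (-1 : ℝ) arcsineEGF = besselSeries * besselSeries := by
  have h1 : expSeries (-1 / 2) * expSeries (1 / 2) = 1 := by
    rw [expSeries_mul]
    norm_num [expSeries]
  have h2 : arcsineEGF = besselSeries * expSeries (1 / 2) := by
    rw [besselSeries, mul_assoc, h1, mul_one]
  have h3 : PowerSeries.rescale (-1 : ℝ) (expSeries (1 / 2)) = expSeries (-1 / 2) := by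
    rw [expSeries, PowerSeries.rescale_rescale, expSeries]
    norm_num
  have h4 : PowerSeries.rescale (-1 : ℝ) arcsineEGF = besselSeries * expSeries (-1 / 2) := by
    rw [h2, map_mul, rescale_neg_one_besselSeries, h3]
  rw [h4]
  nth_rewrite 1 [h2]
  linear_combination besselSeries * besselSeries * h1

theorem coeff_besselSeries_sq_of_odd (k : ℕ) :
    PowerSeries.coeff (2 * k + 1) (besselSeries * besselSeries) = 0 := by
  rw [PowerSeries.coeff_mul]
  refine Finset.sum_eq_zero fun P hP => ?_
  have h := Finset.HasAntidiagonal.mem_antidiagonal.1 hP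
  rcases Nat.even_or_odd' P.1 with ⟨a, ha | ha⟩
  · rw [show P.2 = 2 * (k - a) + 1 by omega, coeff_besselSeries_of_odd, mul_zero]
  · rw [ha, coeff_besselSeries_of_odd, zero_mul]

/-- Only pairs of even indices survive, and ∑ binom(k, a) binom(k, k-a) is the central binomial
coefficient. -/
theorem coeff_besselSeries_sq_two_mul (k : ℕ) :
    PowerSeries.coeff (2 * k) (besselSeries * besselSeries) =
      (k.centralBinom : ℝ) / (16 ^ k * (k.factorial : ℝ) ^ 2) := by
  rw [PowerSeries.coeff_mul]
  have h : ∑ P ∈ Finset.HasAntidiagonal.antidiagonal k,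
      ((k.choose P.1 : ℝ) * (k.choose P.2 : ℝ)) / (16 ^ k * (k.factorial : ℝ) ^ 2) =
      ∑ P ∈ Finset.HasAntidiagonal.antidiagonal (2 * k),
        PowerSeries.coeff P.1 besselSeries * PowerSeries.coeff P.2 besselSeries := by
    refine Finset.sum_of_injOn (fun P => (2 * P.1, 2 * P.2)) ?_ ?_ ?_ ?_
    · rintro ⟨a, b⟩ _ ⟨c, d⟩ _ h
      simp only [Prod.mk.injEq] at h ⊢
      omega
    · rintro ⟨a, b⟩ h
      simp only [Finset.mem_coe, Finset.HasAntidiagonal.mem_antidiagonal] at h ⊢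
      omega
    · rintro ⟨a, b⟩ h hn
      simp only [Finset.HasAntidiagonal.mem_antidiagonal] at h
      rcases Nat.even_or_odd' a with ⟨c, rfl | rfl⟩
      · refine absurd ⟨(c, k - c), ?_, ?_⟩ hn
        · simp only [Finset.mem_coe, Finset.HasAntidiagonal.mem_antidiagonal]
          omega
        · simp only [Prod.mk.injEq, true_and]
          omega
      · rw [coeff_besselSeries_of_odd, zero_mul]
    · rintro ⟨a, b⟩ h
      have h' := Finset.HasAntidiagonal.mem_antidiagonal.1 h
      simp only at h'
      subst h'
      have hab := Nat.add_choose_mul_factorial_mul_factorial a b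
      have hba : (a + b).choose b = (a + b).choose a := by
        rw [← Nat.choose_symm_add]
      simp only [coeff_besselSeries_two_mul]
      have h1 : (a.factorial : ℝ) ≠ 0 := by exact_mod_cast a.factorial_ne_zero
      have h2 : (b.factorial : ℝ) ≠ 0 := by exact_mod_cast b.factorial_ne_zero
      have h3 : (((a + b).choose a : ℕ) : ℝ) ≠ 0 := by
        exact_mod_cast (Nat.choose_pos (Nat.le_add_right a b)).ne'
      rw [hba] at hab ⊢
      rw [← hab, pow_add]
      push_cast
      field_simp
  rw [← h, ← Finset.sum_div]
  congr 1
  rw [Nat.centralBinom, two_mul, Nat.add_choose_eq]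
  push_cast
  rfl

/-- `∑ (-1)^t a_s a_t / (s! t!)` over `s + t = r`, which is `1 / r!` times the eigenvalue of `Q`
on polynomials of degree `r`. -/
theorem sum_neg_one_pow_arcsineWeight (r : ℕ) :
    ∑ P ∈ Finset.HasAntidiagonal.antidiagonal r, arcsineWeight P.1 * arcsineWeight P.2 *
        ((-1) ^ P.2 / ((P.1.factorial : ℝ) * (P.2.factorial : ℝ))) =
      (if Even r then burnsideEigenvalue (r / 2) else 0) / (r.factorial : ℝ) := by
  have h : ∑ P ∈ Finset.HasAntidiagonal.antidiagonal r, arcsineWeight P.1 * arcsineWeight P.2 *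
        ((-1) ^ P.2 / ((P.1.factorial : ℝ) * (P.2.factorial : ℝ))) =
      PowerSeries.coeff r (besselSeries * besselSeries) := by
    rw [← arcsineEGF_mul_rescale, PowerSeries.coeff_mul]
    refine Finset.sum_congr rfl fun P _ => ?_
    simp only [arcsineEGF, PowerSeries.coeff_rescale, PowerSeries.coeff_mk]
    ring
  rw [h]
  rcases Nat.even_or_odd' r with ⟨k, rfl | rfl⟩
  · rw [if_pos (even_two_mul k), Nat.mul_div_cancel_left k two_pos, coeff_besselSeries_sq_two_mul,
      burnsideEigenvalue, ← Nat.centralBinom, pow_mul]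
    -- Replacing (2k)! by `centralBinom k` times (k!)² supplies the second central binomial factor
    -- of the eigenvalue.
    have h1 := Nat.choose_mul_factorial_mul_factorial (show k ≤ 2 * k by omega)
    rw [← Nat.centralBinom, show 2 * k - k = k by omega] at h1
    rw [← h1]
    have h2 : (k.centralBinom : ℝ) ≠ 0 := by exact_mod_cast k.centralBinom_ne_zero
    have h3 : (k.factorial : ℝ) ≠ 0 := by exact_mod_cast k.factorial_ne_zero
    push_cast
    norm_num
    field_simp
  · rw [if_neg (by simp), coeff_besselSeries_sq_of_odd, zero_div]

/-! ### Triangularity with respect to degree -/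

/-- The polynomial `X (X - 1) ⋯ (X - s + 1) / s!`. -/
noncomputable def choosePoly (s : ℕ) : ℝ[X] := C (1 / (s.factorial : ℝ)) * descPochhammer ℝ s

theorem eval_natCast_choosePoly (s m : ℕ) : (choosePoly s).eval (m : ℝ) = (m.choose s : ℝ) := by
  have : (s.factorial : ℝ) ≠ 0 := by exact_mod_cast s.factorial_ne_zero
  rw [choosePoly, eval_mul, eval_C, descPochhammer_eval_eq_descFactorial,
    Nat.descFactorial_eq_factorial_mul_choose]
  push_cast
  field_simp

theorem natDegree_choosePoly_le (s : ℕ) : (choosePoly s).natDegree ≤ s :=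
  (natDegree_C_mul_le _ _).trans (descPochhammer_natDegree ℝ s).le

theorem coeff_choosePoly (s : ℕ) : (choosePoly s).coeff s = 1 / (s.factorial : ℝ) := by
  have h := (monic_descPochhammer ℝ s).coeff_natDegree
  rw [descPochhammer_natDegree] at h
  rw [choosePoly, coeff_C_mul, h, mul_one]

theorem natDegree_C_sub_X_le (c : ℝ) : (C c - X : ℝ[X]).natDegree ≤ 1 := by
  compute_degree

theorem natDegree_comp_C_sub_X_le {p : ℝ[X]} {s : ℕ} (hp : p.natDegree ≤ s) (c : ℝ) :
    (p.comp (C c - X)).natDegree ≤ s := by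
  refine natDegree_comp_le.trans ?_
  calc p.natDegree * (C c - X : ℝ[X]).natDegree ≤ s * 1 :=
        Nat.mul_le_mul hp (natDegree_C_sub_X_le c)
    _ = s := mul_one s

theorem coeff_comp_C_sub_X {p : ℝ[X]} {s : ℕ} (hp : p.natDegree ≤ s) (c : ℝ) :
    (p.comp (C c - X)).coeff s = (-1) ^ s * p.coeff s := by
  rcases hp.eq_or_lt with h | h
  · have hq : (C c - X : ℝ[X]) = -X + C c := by ring
    have hd : (C c - X : ℝ[X]).natDegree = 1 := by
      rw [hq, natDegree_add_C, natDegree_neg, natDegree_X]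
    have hl : (C c - X : ℝ[X]).leadingCoeff = -1 := by
      rw [leadingCoeff, hd]
      simp
    have h1 := coeff_comp_degree_mul_degree (p := p) (q := C c - X) (by rw [hd]; exact one_ne_zero)
    rw [hd, hl, mul_one, h, leadingCoeff, h] at h1
    rw [h1, mul_comm]
  · rw [coeff_eq_zero_of_natDegree_lt h, mul_zero,
      coeff_eq_zero_of_natDegree_lt ((natDegree_comp_C_sub_X_le le_rfl c).trans_lt h)]

/-- Evaluation of a polynomial on `{0, …, n}`. -/
noncomputable def evalFun (n : ℕ) : ℝ[X] →ₗ[ℝ] (Fin (n + 1) → ℝ) :=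
  LinearMap.pi fun i => Polynomial.leval (i : ℝ)

theorem evalFun_apply (n : ℕ) (p : ℝ[X]) (i : Fin (n + 1)) : evalFun n p i = p.eval (i : ℝ) := rfl

/-- The functions on `{0, …, n}` given by polynomials of degree less than `r`. -/
noncomputable def polyFuns (n r : ℕ) : Submodule ℝ (Fin (n + 1) → ℝ) :=
  (degreeLT ℝ r).map (evalFun n)

theorem mem_degreeLT_succ_of_natDegree_le {p : ℝ[X]} {r : ℕ} (h : p.natDegree ≤ r) :
    p ∈ degreeLT ℝ (r + 1) := by
  rw [mem_degreeLT]
  exact degree_lt_iff_coeff_zero _ _ |>.2 fun m hm => coeff_eq_zero_of_natDegree_lt (by omega)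

theorem sub_smul_mem_degreeLT {p b : ℝ[X]} {r : ℕ} {c : ℝ} (hp : p ∈ degreeLT ℝ (r + 1))
    (hb : b ∈ degreeLT ℝ (r + 1)) (h : p.coeff r = c * b.coeff r) :
    p - c • b ∈ degreeLT ℝ r := by
  rw [mem_degreeLT, degree_lt_iff_coeff_zero] at *
  intro m hm
  rw [coeff_sub, coeff_smul, smul_eq_mul]
  rcases hm.eq_or_lt with rfl | hlt
  · rw [h, sub_self]
  · rw [hp m hlt, hb m hlt, mul_zero, sub_zero]

/-- The image of `choosePoly r` under the lumped Burnside kernel, as a polynomial. -/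
noncomputable def kernelChoosePoly (n r : ℕ) : ℝ[X] :=
  ∑ P ∈ Finset.HasAntidiagonal.antidiagonal r,
    C (arcsineWeight P.1 * arcsineWeight P.2) *
      (choosePoly P.1 * (choosePoly P.2).comp (C (n : ℝ) - X))

theorem toLin'_evalFun_choosePoly (n r : ℕ) :
    Matrix.toLin' (lumpedKernel n) (evalFun n (choosePoly r)) =
      evalFun n (kernelChoosePoly n r) := by
  funext i
  have h : evalFun n (choosePoly r) = fun j : Fin (n + 1) => ((j : ℕ).choose r : ℝ) := by
    funext j
    rw [evalFun_apply, eval_natCast_choosePoly]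
  have hi : (n : ℝ) - (i : ℕ) = ((n - (i : ℕ) : ℕ) : ℝ) := by
    rw [Nat.cast_sub (Nat.lt_succ_iff.1 i.is_lt)]
  rw [Matrix.toLin'_apply, h, lumpedKernel_mulVec_choose, evalFun_apply, kernelChoosePoly,
    eval_finsetSum]
  refine Finset.sum_congr rfl fun P _ => ?_
  rw [eval_mul, eval_C, eval_mul, eval_comp, eval_sub, eval_C, eval_X, hi,
    eval_natCast_choosePoly, eval_natCast_choosePoly]

theorem natDegree_kernelChoosePoly_le (n r : ℕ) : (kernelChoosePoly n r).natDegree ≤ r := by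
  refine natDegree_sum_le_of_forall_le _ _ fun P hP => (natDegree_C_mul_le _ _).trans ?_
  have h := Finset.HasAntidiagonal.mem_antidiagonal.1 hP
  calc _ ≤ _ := natDegree_mul_le
    _ ≤ P.1 + P.2 := Nat.add_le_add (natDegree_choosePoly_le _)
      (natDegree_comp_C_sub_X_le (natDegree_choosePoly_le _) _)
    _ = r := h

/-- The eigenvalue of the lumped Burnside kernel belonging to polynomials of degree `r`. -/
noncomputable def degreeEigenvalue (r : ℕ) : ℝ :=
  if Even r then burnsideEigenvalue (r / 2) else 0

theorem coeff_kernelChoosePoly (n r : ℕ) :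
    (kernelChoosePoly n r).coeff r = degreeEigenvalue r * (choosePoly r).coeff r := by
  rw [coeff_choosePoly, mul_one_div, degreeEigenvalue, ← sum_neg_one_pow_arcsineWeight,
    kernelChoosePoly, finsetSum_coeff]
  refine Finset.sum_congr rfl fun P hP => ?_
  have h := Finset.HasAntidiagonal.mem_antidiagonal.1 hP
  rw [coeff_C_mul, ← h, coeff_mul_add_eq_of_natDegree_le (natDegree_choosePoly_le _)
      (natDegree_comp_C_sub_X_le (natDegree_choosePoly_le _) _),
    coeff_comp_C_sub_X (natDegree_choosePoly_le _), coeff_choosePoly, coeff_choosePoly]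
  ring

/-- The r-th graded piece is spanned by `choosePoly r`, where the scalar is known; `ih` takes care
of the lower-degree remainder of `p`. -/
theorem toLin'_evalFun_sub_mem (n r : ℕ)
    (ih : ∀ v ∈ polyFuns n r, Matrix.toLin' (lumpedKernel n) v ∈ polyFuns n r)
    {p : ℝ[X]} (hp : p ∈ degreeLT ℝ (r + 1)) :
    Matrix.toLin' (lumpedKernel n) (evalFun n p) - degreeEigenvalue r • evalFun n p ∈
      polyFuns n r := by
  have hb := mem_degreeLT_succ_of_natDegree_le (natDegree_choosePoly_le r)
  have hk := mem_degreeLT_succ_of_natDegree_le (natDegree_kernelChoosePoly_le n r)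
  have hf : (r.factorial : ℝ) ≠ 0 := by exact_mod_cast r.factorial_ne_zero
  have h1 : p - (p.coeff r * r.factorial) • choosePoly r ∈ degreeLT ℝ r :=
    sub_smul_mem_degreeLT hp hb (by rw [coeff_choosePoly]; field_simp)
  have h2 : kernelChoosePoly n r - degreeEigenvalue r • choosePoly r ∈ degreeLT ℝ r :=
    sub_smul_mem_degreeLT hk hb (coeff_kernelChoosePoly n r)
  have m1 : evalFun n (p - (p.coeff r * r.factorial) • choosePoly r) ∈ polyFuns n r :=
    Submodule.mem_map_of_mem h1
  have m2 : evalFun n (kernelChoosePoly n r - degreeEigenvalue r • choosePoly r) ∈ polyFuns n r :=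
    Submodule.mem_map_of_mem h2
  have m3 := ih _ m1
  have e : Matrix.toLin' (lumpedKernel n) (evalFun n p) - degreeEigenvalue r • evalFun n p =
      Matrix.toLin' (lumpedKernel n)
        (evalFun n (p - (p.coeff r * r.factorial) • choosePoly r)) +
      (p.coeff r * r.factorial) •
        evalFun n (kernelChoosePoly n r - degreeEigenvalue r • choosePoly r) -
      degreeEigenvalue r • evalFun n (p - (p.coeff r * r.factorial) • choosePoly r) := by
    simp only [map_sub, map_smul, toLin'_evalFun_choosePoly]
    module
  rw [e]
  exact Submodule.sub_mem _ (Submodule.add_mem _ m3 (Submodule.smul_mem _ _ m2))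
    (Submodule.smul_mem _ _ m1)

theorem polyFuns_mono {n r s : ℕ} (h : r ≤ s) : polyFuns n r ≤ polyFuns n s :=
  Submodule.map_mono (degreeLT_mono h)

theorem toLin'_mem_polyFuns (n r : ℕ) :
    ∀ v ∈ polyFuns n r, Matrix.toLin' (lumpedKernel n) v ∈ polyFuns n r := by
  induction r with
  | zero =>
    rintro v ⟨p, hp, rfl⟩
    have h0 : p = 0 := by
      ext m
      exact (degree_lt_iff_coeff_zero _ _).1 (mem_degreeLT.1 hp) m (Nat.zero_le m)
    subst h0
    simp
  | succ r ih =>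
    rintro v ⟨p, hp, rfl⟩
    have h := polyFuns_mono (Nat.le_succ r) (toLin'_evalFun_sub_mem n r ih hp)
    have h' : degreeEigenvalue r • evalFun n p ∈ polyFuns n (r + 1) :=
      Submodule.smul_mem _ _ (Submodule.mem_map_of_mem hp)
    simpa using Submodule.add_mem _ h h'

/-! ### Orthogonality of the discrete Chebyshev polynomials -/

/-- Sort the subsets of size l + m + 1 by the position of their (l+1)-st element. -/
theorem sum_antidiagonal_choose_mul_choose (n l m : ℕ) :
    ∑ P ∈ Finset.HasAntidiagonal.antidiagonal n, P.1.choose l * P.2.choose m =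
      (n + 1).choose (l + m + 1) := by
  induction n generalizing m with
  | zero =>
    rw [Finset.Nat.antidiagonal_zero, Finset.sum_singleton]
    rcases l with _ | l <;> rcases m with _ | m <;> simp [Nat.choose_eq_zero_of_lt]
  | succ n ih =>
    rw [Finset.Nat.sum_antidiagonal_succ']
    cases m with
    | zero =>
      have h := ih 0
      simp only [Nat.choose_zero_right, mul_one, add_zero] at h ⊢
      rw [h, Nat.choose_succ_succ' (n + 1) l]
    | succ m =>
      simp only [Nat.choose_zero_succ, mul_zero, zero_add, Nat.choose_succ_succ' _ m, mul_add,
        Finset.sum_add_distrib, ih]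
      exact (Nat.choose_succ_succ' _ _).symm

/-- As a function of l, the product of falling factorials on the right is a polynomial of degree (j
- m - 1) + m < j, which a j-th difference annihilates. -/
theorem chebyshev_choose_identity {n j l m : ℕ} (hm : m < j) (hl : l ≤ n) :
    (j + l).choose l * (n + 1).choose (l + m + 1) * j.factorial =
      n.choose l * ((n + 1) * ((j + l).descFactorial (j - m - 1) * (n - l).descFactorial m)) := by
  rcases le_or_gt (l + m) n with h | h
  · have k1 := Nat.choose_mul_factorial_mul_factorial hl
    have k2 := Nat.choose_mul_factorial_mul_factorial (show l + m + 1 ≤ n + 1 by omega)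
    have k3 := Nat.choose_mul_factorial_mul_factorial (show l ≤ j + l by omega)
    have k4 := Nat.factorial_mul_descFactorial (show m ≤ n - l by omega)
    have k5 := Nat.factorial_mul_descFactorial (show j - m - 1 ≤ j + l by omega)
    rw [show j + l - l = j by omega] at k3
    rw [show n + 1 - (l + m + 1) = n - l - m by omega, Nat.factorial_succ n] at k2
    rw [show j + l - (j - m - 1) = l + m + 1 by omega] at k5
    have hpos : 0 < (l + m + 1).factorial * (n - l - m).factorial * l.factorial := by positivity
    apply Nat.eq_of_mul_eq_mul_right hpos
    calc _ = ((j + l).choose l * l.factorial * j.factorial) * ((n + 1).choose (l + m + 1) *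
          (l + m + 1).factorial * (n - l - m).factorial) := by ring
      _ = (n + 1) * (n.choose l * l.factorial * (n - l).factorial) * (j + l).factorial := by
          rw [k2, k3, k1]; ring
      _ = _ := by rw [← k4, ← k5]; ring
  · rw [Nat.choose_eq_zero_of_lt (show n + 1 < l + m + 1 by omega),
      Nat.descFactorial_eq_zero_iff_lt.2 (show n - l < m by omega)]
    ring

theorem sum_neg_one_pow_choose_mul_eval {p : ℝ[X]} {j : ℕ} (hp : p.natDegree < j) :
    ∑ l ∈ Finset.range (j + 1), (-1) ^ l * (j.choose l : ℝ) * p.eval (l : ℝ) = 0 := by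
  have h := congrFun (fwdDiff_iter_eq_zero_of_degree_lt hp) 0
  rw [fwdDiff_iter_eq_sum_shift] at h
  have h2 : ∑ l ∈ Finset.range (j + 1), (-1) ^ l * (j.choose l : ℝ) * p.eval (l : ℝ) =
      (-1) ^ j * ∑ k ∈ Finset.range (j + 1),
        ((-1 : ℤ) ^ (j - k) * (j.choose k : ℤ)) • p.eval (0 + k • (1 : ℝ)) := by
    rw [Finset.mul_sum]
    refine Finset.sum_congr rfl fun k hk => ?_
    have hk' : k ≤ j := Nat.lt_succ_iff.1 (Finset.mem_range.1 hk)
    have : (-1 : ℝ) ^ j * (-1) ^ (j - k) = (-1) ^ k := by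
      rw [← pow_add, show j + (j - k) = k + 2 * (j - k) by omega, pow_add, pow_mul]
      norm_num
    rw [zsmul_eq_mul, zero_add, nsmul_eq_mul, mul_one]
    push_cast
    rw [← this]
    ring
  rw [h2, h]
  simp

theorem ascPochhammer_eval_neg_natCast (l m : ℕ) :
    (ascPochhammer ℝ l).eval (-(m : ℝ)) = (-1) ^ l * ((l.factorial : ℝ) * (m.choose l : ℝ)) := by
  rw [ascPochhammer_eval_neg_eq_descPochhammer, descPochhammer_eval_eq_descFactorial,
    Nat.descFactorial_eq_factorial_mul_choose]
  push_cast
  ring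

theorem eval_natCast_discreteChebyshev {n j : ℕ} (hj : j ≤ n) (x : ℕ) :
    (discreteChebyshev n j).eval (x : ℝ) = ∑ l ∈ Finset.range (j + 1),
      (-1) ^ l * (j.choose l : ℝ) * ((j + l).choose l / n.choose l : ℝ) * (x.choose l : ℝ) := by
  rw [discreteChebyshev, eval_finsetSum]
  refine Finset.sum_congr rfl fun l hl => ?_
  have hl' : l ≤ j := Nat.lt_succ_iff.1 (Finset.mem_range.1 hl)
  have h1 : (ascPochhammer ℝ l).eval 1 = (l.factorial : ℝ) := ascPochhammer_eval_one ℝ l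
  have h2 : (ascPochhammer ℝ l).eval ((j : ℝ) + 1) =
      (l.factorial : ℝ) * ((j + l).choose l : ℝ) := by
    have := ascPochhammer_nat_eq_natCast_ascFactorial ℝ (j + 1) l
    rw [Nat.ascFactorial_eq_factorial_mul_choose] at this
    push_cast at this
    exact this
  have hf : (l.factorial : ℝ) ≠ 0 := by exact_mod_cast l.factorial_ne_zero
  have hc : (n.choose l : ℝ) ≠ 0 := by
    exact_mod_cast (Nat.choose_pos (hl'.trans hj)).ne'
  have hs : ((-1 : ℝ) ^ l) ≠ 0 := by simp
  rw [eval_mul, eval_C, eval_comp, eval_neg, eval_X]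
  simp only [ascPochhammer_eval_neg_natCast, h1, h2]
  field_simp

/-- Testing against binom(n - x, m) instead of binom(x, m) collapses each sum over x to one
binomial; what remains is a j-th difference of the polynomial `p`. -/
theorem sum_chebyshevFun_mul_choose {n j m : ℕ} (hj : j ≤ n) (hm : m < j) :
    ∑ x : Fin (n + 1), chebyshevFun n j x * ((n - (x : ℕ)).choose m : ℝ) = 0 := by
  simp only [chebyshevFun, eval_natCast_discreteChebyshev hj, Finset.sum_mul]
  rw [Finset.sum_comm]
  have h1 : ∀ l, ∑ x : Fin (n + 1), ((x : ℕ).choose l : ℝ) * ((n - (x : ℕ)).choose m : ℝ) =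
      ((n + 1).choose (l + m + 1) : ℝ) := by
    intro l
    rw [Fin.sum_univ_eq_sum_range
      (fun x : ℕ => (x.choose l : ℝ) * ((n - x).choose m : ℝ)) (n + 1),
      ← Finset.Nat.sum_antidiagonal_eq_sum_range_succ
      (fun a b : ℕ => (a.choose l : ℝ) * (b.choose m : ℝ)),
      ← sum_antidiagonal_choose_mul_choose]
    push_cast
    rfl
  let p : ℝ[X] := (descPochhammer ℝ (j - m - 1)).comp (X + C (j : ℝ)) *
    (descPochhammer ℝ m).comp (C (n : ℝ) - X)
  have hp : p.natDegree < j := by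
    have e1 : (X + C (j : ℝ)).natDegree ≤ 1 := by compute_degree
    have e2 : (C (n : ℝ) - X).natDegree ≤ 1 := by compute_degree
    have d1 : ((descPochhammer ℝ (j - m - 1)).comp (X + C (j : ℝ))).natDegree ≤ j - m - 1 := by
      refine natDegree_comp_le.trans ?_
      rw [descPochhammer_natDegree]
      simpa using Nat.mul_le_mul_left (j - m - 1) e1
    have d2 : ((descPochhammer ℝ m).comp (C (n : ℝ) - X)).natDegree ≤ m := by
      refine natDegree_comp_le.trans ?_
      rw [descPochhammer_natDegree]
      simpa using Nat.mul_le_mul_left m e2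
    have := (natDegree_mul_le (p := (descPochhammer ℝ (j - m - 1)).comp (X + C (j : ℝ)))
      (q := (descPochhammer ℝ m).comp (C (n : ℝ) - X))).trans (Nat.add_le_add d1 d2)
    show natDegree (_ * _) < j
    omega
  have hpe : ∀ l, l ≤ n → p.eval (l : ℝ) =
      ((j + l).descFactorial (j - m - 1) : ℝ) * ((n - l).descFactorial m : ℝ) := by
    intro l hl
    rw [show p = _ * _ from rfl, eval_mul, eval_comp, eval_comp, eval_add, eval_sub, eval_X,
      eval_C, eval_C,
      ← Nat.cast_sub hl, ← Nat.cast_add, descPochhammer_eval_eq_descFactorial,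
      descPochhammer_eval_eq_descFactorial, add_comm l j]
  have hjf : (j.factorial : ℝ) ≠ 0 := by exact_mod_cast j.factorial_ne_zero
  have h2 := sum_neg_one_pow_choose_mul_eval hp
  rw [← mul_zero (((n : ℝ) + 1) / j.factorial), ← h2, Finset.mul_sum]
  refine Finset.sum_congr rfl fun l hl => ?_
  have hl' : l ≤ n := (Nat.lt_succ_iff.1 (Finset.mem_range.1 hl)).trans hj
  have hc : (n.choose l : ℝ) ≠ 0 := by exact_mod_cast (Nat.choose_pos hl').ne'
  have key : ((j + l).choose l : ℝ) * ((n + 1).choose (l + m + 1) : ℝ) * (j.factorial : ℝ) =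
      (n.choose l : ℝ) * (((n : ℝ) + 1) *
        (((j + l).descFactorial (j - m - 1) : ℝ) * ((n - l).descFactorial m : ℝ))) := by
    exact_mod_cast chebyshev_choose_identity hm hl'
  simp only [mul_assoc]
  simp only [← Finset.mul_sum]
  rw [h1, hpe l hl']
  field_simp
  linear_combination (j.choose l : ℝ) * key

theorem chebyshevFun_eq_evalFun (n j : ℕ) :
    chebyshevFun n j = evalFun n (discreteChebyshev n j) := rfl

theorem natDegree_discreteChebyshev_le (n j : ℕ) : (discreteChebyshev n j).natDegree ≤ j := by
  refine natDegree_sum_le_of_forall_le _ _ fun l hl => (natDegree_C_mul_le _ _).trans ?_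
  refine natDegree_comp_le.trans ?_
  rw [ascPochhammer_natDegree, natDegree_neg, natDegree_X, mul_one]
  exact Nat.lt_succ_iff.1 (Finset.mem_range.1 hl)

theorem discreteChebyshev_mem_degreeLT (n j : ℕ) :
    discreteChebyshev n j ∈ degreeLT ℝ (j + 1) :=
  mem_degreeLT_succ_of_natDegree_le (natDegree_discreteChebyshev_le n j)

theorem chebyshevFun_dotProduct_of_le {n j r : ℕ} (hj : j ≤ n) (hr : r ≤ j) :
    ∀ v ∈ polyFuns n r, dotProduct (chebyshevFun n j) v = 0 := by
  induction r with
  | zero =>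
    rintro v ⟨p, hp, rfl⟩
    have h0 : p = 0 := by
      ext m
      exact (degree_lt_iff_coeff_zero _ _).1 (mem_degreeLT.1 hp) m (Nat.zero_le m)
    subst h0
    simp
  | succ r ih =>
    rintro v ⟨p, hp, rfl⟩
    have hd := natDegree_comp_C_sub_X_le (natDegree_choosePoly_le r) (n : ℝ)
    have hb := mem_degreeLT_succ_of_natDegree_le hd
    have hf : (r.factorial : ℝ) ≠ 0 := by exact_mod_cast r.factorial_ne_zero
    have hs : (-1 : ℝ) ^ r * (-1) ^ r = 1 := by
      rw [← mul_pow]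
      norm_num
    set b : ℝ[X] := (choosePoly r).comp (C (n : ℝ) - X) with hbdef
    set c : ℝ := p.coeff r * ((-1) ^ r * r.factorial) with hc
    have h1 : p - c • b ∈ degreeLT ℝ r := by
      refine sub_smul_mem_degreeLT hp hb ?_
      rw [hbdef, coeff_comp_C_sub_X (natDegree_choosePoly_le r), coeff_choosePoly, hc]
      field_simp
      linear_combination -p.coeff r * hs
    have h2 := ih (Nat.le_of_succ_le hr) _ (Submodule.mem_map_of_mem h1)
    have h3 : dotProduct (chebyshevFun n j) (evalFun n b) = 0 := by
      rw [← sum_chebyshevFun_mul_choose hj (Nat.lt_of_succ_le hr), dotProduct]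
      refine Finset.sum_congr rfl fun x _ => ?_
      rw [evalFun_apply, hbdef, eval_comp, eval_sub, eval_C, eval_X,
        ← Nat.cast_sub (Nat.lt_succ_iff.1 x.is_lt), eval_natCast_choosePoly]
    rw [map_sub, map_smul, dotProduct_sub, dotProduct_smul, h3, smul_zero, sub_zero] at h2
    exact h2

/-! ### Diagonalization -/

theorem dotProduct_toLin'_lumpedKernel (n : ℕ) (v w : Fin (n + 1) → ℝ) :
    dotProduct (Matrix.toLin' (lumpedKernel n) v) w =
      dotProduct v (Matrix.toLin' (lumpedKernel n) w) := by
  rw [Matrix.toLin'_apply, Matrix.toLin'_apply, Matrix.dotProduct_mulVec,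
    ← Matrix.mulVec_transpose, (lumpedKernel_isSymm n).eq]

/-- The defect w = QT - λT has degree below j, and so does Qw. Both are orthogonal to T, so ⟨w, w⟩ =
⟨T, Qw⟩ - λ⟨T, w⟩ = 0 by symmetry of Q. -/
theorem toLin'_chebyshevFun {n j : ℕ} (hj : j ≤ n) :
    Matrix.toLin' (lumpedKernel n) (chebyshevFun n j) =
      degreeEigenvalue j • chebyshevFun n j := by
  have hw := toLin'_evalFun_sub_mem n j (toLin'_mem_polyFuns n j)
    (discreteChebyshev_mem_degreeLT n j)
  rw [← chebyshevFun_eq_evalFun] at hw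
  have h1 := chebyshevFun_dotProduct_of_le hj le_rfl _ hw
  have h2 := chebyshevFun_dotProduct_of_le hj le_rfl _ (toLin'_mem_polyFuns n j _ hw)
  rw [← dotProduct_toLin'_lumpedKernel] at h2
  rw [← sub_eq_zero, ← dotProduct_self_eq_zero]
  rw [sub_dotProduct, smul_dotProduct, h1, h2, smul_zero, sub_zero]

theorem chebyshevFun_ne_zero {n j : ℕ} (hj : j ≤ n) : chebyshevFun n j ≠ 0 := by
  intro h
  have h0 := congrFun h 0
  have h1 := eval_natCast_discreteChebyshev hj 0
  rw [Finset.sum_range_succ'] at h1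
  simp only [Nat.choose_zero_succ, Nat.cast_zero, mul_zero, Finset.sum_const_zero] at h1
  simp [chebyshevFun, h1] at h0

theorem chebyshevFun_dotProduct_of_ne {n i j : ℕ} (hi : i ≤ n) (hj : j ≤ n) (h : i ≠ j) :
    dotProduct (chebyshevFun n i) (chebyshevFun n j) = 0 := by
  have key : ∀ a b : ℕ, b ≤ n → a < b →
      dotProduct (chebyshevFun n b) (chebyshevFun n a) = 0 := fun a b hb hab =>
    chebyshevFun_dotProduct_of_le hb hab _
      (Submodule.mem_map_of_mem (discreteChebyshev_mem_degreeLT n a))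
  rcases h.lt_or_gt with h | h
  · rw [dotProduct_comm]
    exact key i j hj h
  · exact key j i hi h

theorem linearIndependent_chebyshevFun (n : ℕ) :
    LinearIndependent ℝ fun j : Fin (n + 1) => chebyshevFun n j := by
  rw [Fintype.linearIndependent_iff]
  intro g hg i
  have hle : ∀ j : Fin (n + 1), (j : ℕ) ≤ n := fun j => Nat.lt_succ_iff.1 j.is_lt
  have h := congrArg (dotProduct (chebyshevFun n i)) hg
  rw [dotProduct_sum, dotProduct_zero, Finset.sum_eq_single i] at h
  · rw [dotProduct_smul, smul_eq_mul] at h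
    refine (mul_eq_zero.1 h).resolve_right fun h' => ?_
    exact chebyshevFun_ne_zero (hle i) (dotProduct_self_eq_zero.1 h')
  · intro j _ hj
    rw [dotProduct_smul, chebyshevFun_dotProduct_of_ne (hle i) (hle j)
      fun h => hj (Fin.ext h.symm), smul_zero]
  · intro h
    exact absurd (Finset.mem_univ i) h

/-- The discrete Chebyshev polynomials as a basis of the functions on `{0, …, n}`. -/
noncomputable def chebyshevBasis (n : ℕ) : Module.Basis (Fin (n + 1)) ℝ (Fin (n + 1) → ℝ) :=
  basisOfLinearIndependentOfCardEqFinrank (linearIndependent_chebyshevFun n) (by simp)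

theorem chebyshevBasis_apply (n : ℕ) (j : Fin (n + 1)) :
    chebyshevBasis n j = chebyshevFun n j := by
  simp [chebyshevBasis]

/-! ### Eigenspaces and simplicity -/

/-- An eigenspace of a diagonalized endomorphism is spanned by the basis vectors in it. -/
theorem eigenspace_eq_span_of_basis {ι K V : Type*} [Fintype ι] [Field K] [AddCommGroup V]
    [Module K V] (b : Module.Basis ι K V) (f : Module.End K V) (c : ι → K)
    (hf : ∀ i, f (b i) = c i • b i) (μ : K) :
    Module.End.eigenspace f μ = Submodule.span K {v | ∃ i, c i = μ ∧ v = b i} := by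
  apply le_antisymm
  · intro v hv
    rw [Module.End.mem_eigenspace_iff] at hv
    have h1 : ∀ i, c i * b.repr v i = μ * b.repr v i := by
      have h2 : f v = ∑ i, (c i * b.repr v i) • b i := by
        conv_lhs => rw [← b.sum_repr v, map_sum]
        refine Finset.sum_congr rfl fun i _ => ?_
        rw [map_smul, hf, smul_smul, mul_comm]
      intro i
      have h3 := congrArg (fun w => b.repr w i) hv
      simp only [h2, b.repr_sum_self, map_smul, Finsupp.smul_apply, smul_eq_mul] at h3
      exact h3
    rw [← b.sum_repr v]
    refine Submodule.sum_mem _ fun i _ => ?_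
    by_cases h : c i = μ
    · exact Submodule.smul_mem _ _ (Submodule.subset_span ⟨i, h, rfl⟩)
    · have h4 : b.repr v i = 0 := by
        have h5 : (c i - μ) * b.repr v i = 0 := by rw [sub_mul, h1, sub_self]
        exact (mul_eq_zero.1 h5).resolve_left (sub_ne_zero.2 h)
      rw [h4, zero_smul]
      exact Submodule.zero_mem _
  · rw [Submodule.span_le]
    rintro v ⟨i, rfl, rfl⟩
    exact Module.End.mem_eigenspace_iff.2 (hf i)

theorem eigenspace_lumpedKernel (n : ℕ) (μ : ℝ) :
    Module.End.eigenspace (Matrix.toLin' (lumpedKernel n)) μ =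
      Submodule.span ℝ {f | ∃ j : ℕ, j ≤ n ∧ degreeEigenvalue j = μ ∧ f = chebyshevFun n j} := by
  rw [eigenspace_eq_span_of_basis (chebyshevBasis n) _ (fun j => degreeEigenvalue j)
    fun j => by
      rw [chebyshevBasis_apply]
      exact toLin'_chebyshevFun (Nat.lt_succ_iff.1 j.is_lt)]
  congr 1
  ext f
  constructor
  · rintro ⟨j, hj, rfl⟩
    exact ⟨j, Nat.lt_succ_iff.1 j.is_lt, hj, chebyshevBasis_apply n j⟩
  · rintro ⟨j, hj, hμ, rfl⟩
    refine ⟨⟨j, Nat.lt_succ_of_le hj⟩, hμ, ?_⟩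
    rw [chebyshevBasis_apply]

theorem hasEigenvector_chebyshevFun {n j : ℕ} (hj : j ≤ n) :
    Module.End.HasEigenvector (Matrix.toLin' (lumpedKernel n)) (degreeEigenvalue j)
      (chebyshevFun n j) :=
  ⟨Module.End.mem_eigenspace_iff.2 (toLin'_chebyshevFun hj), chebyshevFun_ne_zero hj⟩

theorem hasEigenvalue_lumpedKernel_iff (n : ℕ) (μ : ℝ) :
    Module.End.HasEigenvalue (Matrix.toLin' (lumpedKernel n)) μ ↔
      ∃ j : ℕ, j ≤ n ∧ degreeEigenvalue j = μ := by
  constructor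
  · intro h
    by_contra hne
    apply Module.End.hasEigenvalue_iff.1 h
    rw [eigenspace_lumpedKernel, Submodule.span_eq_bot]
    rintro f ⟨j, hj, hμ, -⟩
    exact absurd ⟨j, hj, hμ⟩ hne
  · rintro ⟨j, hj, rfl⟩
    exact Module.End.hasEigenvalue_of_hasEigenvector (hasEigenvector_chebyshevFun hj)

theorem burnsideEigenvalue_eq_arcsineWeight_sq (k : ℕ) :
    burnsideEigenvalue k = arcsineWeight k ^ 2 := by
  rw [burnsideEigenvalue, arcsineWeight, Nat.centralBinom, div_pow, pow_mul, ← pow_mul 4 k 2,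
    mul_comm k 2, pow_mul]
  norm_num

theorem burnsideEigenvalue_pos (k : ℕ) : 0 < burnsideEigenvalue k := by
  rw [burnsideEigenvalue_eq_arcsineWeight_sq]
  exact pow_pos (arcsineWeight_pos k) 2

theorem burnsideEigenvalue_zero : burnsideEigenvalue 0 = 1 := by simp [burnsideEigenvalue]

/-- The ratio a_{k+1} / a_k = (k + 1/2) / (k + 1) is below 1. This separates the even degrees and
gives simplicity. -/
theorem burnsideEigenvalue_strictAnti : StrictAnti burnsideEigenvalue := by
  refine strictAnti_nat_of_succ_lt fun k => ?_
  rw [burnsideEigenvalue_eq_arcsineWeight_sq, burnsideEigenvalue_eq_arcsineWeight_sq]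
  have h0 := arcsineWeight_pos k
  have h1 := succ_mul_arcsineWeight_succ k
  have hk : (0 : ℝ) < k + 1 := by positivity
  have h2 : arcsineWeight (k + 1) < arcsineWeight k := by
    refine lt_of_mul_lt_mul_left ?_ hk.le
    rw [h1]
    nlinarith
  exact pow_lt_pow_left₀ h2 (arcsineWeight_pos _).le two_ne_zero

theorem degreeEigenvalue_two_mul (k : ℕ) : degreeEigenvalue (2 * k) = burnsideEigenvalue k := by
  rw [degreeEigenvalue, if_pos (even_two_mul k), Nat.mul_div_cancel_left k two_pos]

theorem degreeEigenvalue_eq_zero_iff (j : ℕ) : degreeEigenvalue j = 0 ↔ Odd j := by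
  rw [degreeEigenvalue, ← Nat.not_even_iff_odd]
  split_ifs with h
  · simp [h, (burnsideEigenvalue_pos (j / 2)).ne']
  · simp [h]

theorem degreeEigenvalue_eq_burnsideEigenvalue_iff (j k : ℕ) :
    degreeEigenvalue j = burnsideEigenvalue k ↔ j = 2 * k := by
  constructor
  · intro h
    rcases Nat.even_or_odd' j with ⟨m, rfl | rfl⟩
    · rw [degreeEigenvalue_two_mul] at h
      rw [burnsideEigenvalue_strictAnti.injective h]
    · rw [(degreeEigenvalue_eq_zero_iff _).2 (odd_two_mul_add_one m)] at h
      exact absurd h.symm (burnsideEigenvalue_pos k).ne'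
  · rintro rfl
    exact degreeEigenvalue_two_mul k

theorem eigenspace_burnsideEigenvalue {n k : ℕ} (hk : 2 * k ≤ n) :
    Module.End.eigenspace (Matrix.toLin' (lumpedKernel n)) (burnsideEigenvalue k) =
      Submodule.span ℝ {chebyshevFun n (2 * k)} := by
  rw [eigenspace_lumpedKernel]
  congr 1
  ext f
  simp only [degreeEigenvalue_eq_burnsideEigenvalue_iff, Set.mem_ofPred_eq, Set.mem_singleton_iff]
  constructor
  · rintro ⟨j, -, rfl, rfl⟩
    rfl
  · rintro rfl
    exact ⟨_, hk, rfl, rfl⟩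

theorem theorem2 (n : ℕ) :
    -- the nonzero eigenvalues
    {μ : ℝ | μ ≠ 0 ∧ Module.End.HasEigenvalue (Matrix.toLin' (lumpedKernel n)) μ} =
        {1} ∪ {μ : ℝ | ∃ k : ℕ, 1 ≤ k ∧ k ≤ n / 2 ∧ μ = burnsideEigenvalue k} ∧
    -- the eigenvalue `1` is simple, with the constant functions as eigenfunctions
    Module.End.eigenspace (Matrix.toLin' (lumpedKernel n)) 1 =
        Submodule.span ℝ {chebyshevFun n 0} ∧
    -- the eigenfunction for each eigenvalue other than `0` and `1`
    (∀ k : ℕ, 1 ≤ k → k ≤ n / 2 →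
      Module.End.HasEigenvector (Matrix.toLin' (lumpedKernel n)) (burnsideEigenvalue k)
          (chebyshevFun n (2 * k)) ∧
      Module.End.eigenspace (Matrix.toLin' (lumpedKernel n)) (burnsideEigenvalue k) =
          Submodule.span ℝ {chebyshevFun n (2 * k)}) ∧
    -- the eigenfunctions for the eigenvalue `0`
    (∀ j : ℕ, j ≤ n → Odd j →
      Module.End.HasEigenvector (Matrix.toLin' (lumpedKernel n)) 0 (chebyshevFun n j)) ∧
    Module.End.eigenspace (Matrix.toLin' (lumpedKernel n)) 0 =
        Submodule.span ℝ {f | ∃ j : ℕ, j ≤ n ∧ Odd j ∧ f = chebyshevFun n j} := by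
  refine ⟨?_, ?_, ?_, ?_, ?_⟩
  · ext μ
    simp only [Set.mem_ofPred_eq, Set.mem_union, Set.mem_singleton_iff,
      hasEigenvalue_lumpedKernel_iff]
    constructor
    · rintro ⟨h0, j, hj, rfl⟩
      rcases Nat.even_or_odd' j with ⟨k, rfl | rfl⟩
      · rw [degreeEigenvalue_two_mul]
        rcases Nat.eq_zero_or_pos k with rfl | hk
        · exact Or.inl burnsideEigenvalue_zero
        · exact Or.inr ⟨k, hk, by omega, rfl⟩
      · exact absurd ((degreeEigenvalue_eq_zero_iff _).2 (odd_two_mul_add_one k)) h0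
    · rintro (rfl | ⟨k, hk, hkn, rfl⟩)
      · exact ⟨one_ne_zero, 0, Nat.zero_le n,
          (degreeEigenvalue_two_mul 0).trans burnsideEigenvalue_zero⟩
      · exact ⟨(burnsideEigenvalue_pos k).ne', 2 * k, by omega, degreeEigenvalue_two_mul k⟩
  -- The eigenvalue 1 is the case k = 0 of the general formula.
  · rw [← burnsideEigenvalue_zero]
    exact eigenspace_burnsideEigenvalue (Nat.zero_le n)
  · intro k _ hkn
    have hk : 2 * k ≤ n := by omega
    refine ⟨?_, eigenspace_burnsideEigenvalue hk⟩
    rw [← degreeEigenvalue_two_mul]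
    exact hasEigenvector_chebyshevFun hk
  · intro j hj hodd
    have h := hasEigenvector_chebyshevFun hj
    rwa [(degreeEigenvalue_eq_zero_iff j).2 hodd] at h
  · simp only [eigenspace_lumpedKernel, degreeEigenvalue_eq_zero_iff]
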